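/- Let $T=(V,E)$ be a finite tree. A set $D\subseteq V$ is a total dominating set (TD-set) of $T$ if every vertex of $T$ is adjacent to some element of $D$; it is minimal if no proper subset of it is a TD-set. Assume that $T$ is unmixed, i.e. all minimal TD-sets of $T$ have the same cardinality. The stable complex $\mathcal S(T)$ is the simplicial complex on $V$ generated by the complements of the minimal TD-sets of $T$: its faces are the sets $F\subseteq V\setminus D$ with $D$ a minimal TD-set. Then $\mathcal S(T)$ is shellable, that is, it is pure (all its facets have the same cardinality) and its facets can be listed without repetition as $F_1,\dots,F_m$ in such a way that for all $1\le i<j\le m$ there are a vertex $v\in F_j\setminus F_i$ and an index $k<j$ with $F_j\setminus F_k=\{v\}$. Moreover, the facets of $\mathcal S(T)$ are exactly the complements of the minimal TD-sets of $T$, and for every field $\Bbbk$ the complex $\mathcal S(T)$ is the Stanley–Reisner complex of the open neighborhood ideal $\mathcal N(T)=\langle \prod_{u\in N(v)}u \mid v\in V\rangle\subseteq \Bbbk[V]$, where $N(v)$ is the set of neighbors of $v$; that is, $\mathcal S(T)=\{F\subseteq V \mid \prod_{u\in F}u\notin\mathcal N(T)\}$. (If $T$ has a single vertex there is no TD-set,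 and $\mathcal S(T)$ is the void complex, which counts as shellable with $m=0$.) -/

import Mathlib

namespace OpenNbhd

section Graphs

variable {V : Type*}

/-- A total dominating set (TD-set): every vertex of `G` has a neighbour in `D`, that is,
the union `N(D)` of the open neighbourhoods of the elements of `D` is the whole vertex set. -/
def IsTDSet (G : SimpleGraph V) (D : Finset V) : Prop :=
  (⋃ v ∈ D, G.neighborSet v) = Set.univ

/-- A minimal TD-set: a TD-set no proper subset of which is a TD-set. -/
def IsMinimalTDSet (G : SimpleGraph V) (D : Finset V) : Prop :=
  Minimal (IsTDSet G) D

/-- `G` is unmixed (well totally dominated): all minimal TD-sets have the same size. -/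
def IsUnmixed (G : SimpleGraph V) : Prop :=
  ∀ D D' : Finset V, IsMinimalTDSet G D → IsMinimalTDSet G D' → D.card = D'.card

end Graphs

section Complexes

variable {V : Type*}

/- A simplicial complex on the finite set `V` is a family of subsets of `V` closed under passing
to subsets, i.e. a `LowerSet (Finset V)`. The empty set is allowed as a face. -/

/-- The facets of a simplicial complex: its faces that are maximal under inclusion. -/
def facets (Δ : LowerSet (Finset V)) : Set (Finset V) :=
  {F | Maximal (· ∈ Δ) F}

/-- A simplicial complex is pure if all its facets have the same dimension `|F| - 1`. -/
def IsPure (Δ : LowerSet (Finset V)) : Prop :=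
  ∀ F ∈ facets Δ, ∀ F' ∈ facets Δ, F.card = F'.card

/-- The sequence `F 0, …, F (m - 1)` is a shelling of `Δ`: it lists every facet of `Δ` exactly
once, and for all `i < j` there are a vertex `v ∈ F j \ F i` and an index `k < j` such that
`F j \ F k = {v}`. -/
def IsShelling [DecidableEq V] (Δ : LowerSet (Finset V)) {m : ℕ} (F : Fin m → Finset V) : Prop :=
  Function.Injective F ∧ Set.range F = facets Δ ∧
    ∀ i j : Fin m, i < j → ∃ v ∈ F j \ F i, ∃ k : Fin m, k < j ∧ F j \ F k = {v}

/-- A simplicial complex is shellable if it is pure and has a shelling. -/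
def IsShellable [DecidableEq V] (Δ : LowerSet (Finset V)) : Prop :=
  IsPure Δ ∧ ∃ (m : ℕ) (F : Fin m → Finset V), IsShelling Δ F

end Complexes

section StableComplex

variable {V : Type*} [Fintype V] [DecidableEq V]

/-- `F` is a maximal stable set of `G`: its complement is a minimal TD-set of `G`. -/
def IsMaximalStable (G : SimpleGraph V) (F : Finset V) : Prop :=
  IsMinimalTDSet G Fᶜ

/-- The stable complex `S(G)`: the simplicial complex on `V` generated by the maximal stable
sets of `G`. -/
def stableComplex (G : SimpleGraph V) : LowerSet (Finset V) :=
  lowerClosure {F | IsMaximalStable G F}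

end StableComplex

section Ideals

open MvPolynomial

variable {V : Type*}

/-- The square-free monomial `X_U`, the product of the variables in `U`. -/
noncomputable def setMonomial (K : Type*) [CommRing K] (U : Finset V) : MvPolynomial V K :=
  ∏ v ∈ U, X v

/-- The open neighbourhood ideal `N(G)`, generated by the monomials `X_{N(v)}`, `v ∈ V`. -/
noncomputable def openNeighborhoodIdeal (K : Type*) [CommRing K] [Fintype V]
    (G : SimpleGraph V) [DecidableRel G.Adj] : Ideal (MvPolynomial V K) :=
  Ideal.span {f | ∃ v : V, f = setMonomial K (G.neighborFinset v)}

/-- The Stanley–Reisner complex `{F ⊆ V : X_F ∉ I}` of a (square-free monomial) ideal `I`. -/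
def stanleyReisnerComplex {K : Type*} [CommRing K] (I : Ideal (MvPolynomial V K)) :
    LowerSet (Finset V) where
  carrier := {F | setMonomial K F ∉ I}
  lower' := fun _ _ hGF hF hG =>
    hF (I.mem_of_dvd (Finset.prod_dvd_prod_of_subset _ _ _ hGF) hG)

end Ideals

end OpenNbhd

/-! TD-sets are the transversals of the inclusion-minimal open neighbourhoods. In a tree without
isolated vertices a König-type argument yields a set `M` of pairwise disjoint minimal neighbourhoods
together with a TD-set of size `|M|`. Unmixedness then makes every minimal TD-set a choice of one
vertex from each N(a), a ∈ `M`. Acyclicity puts two shared vertices (those in several minimal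
neighbourhoods) of one N(a) into a common minimal TD-set, so each N(a) has at most one. Rank shared
vertices below all others and order minimal TD-sets by total rank. If `D'` does not precede `D`,
some N(a) has a lower choice in `D` than in `D'`. The choice in `D'` is then not shared, so swapping
it keeps a TD-set and lowers the weight (`DisjointNbhds.exists_exchange`). Complementing gives the
shelling. -/

namespace OpenNbhd

open Finset

section Depth

variable {V : Type*}

/-- A function on the vertices of a graph under which every vertex has at most one neighbour that
is not strictly higher, such as the distance to a root of a tree. -/
def IsDepth (G : SimpleGraph V) (d : V → ℕ) : Prop :=
  ∀ ⦃x y z⦄, G.Adj x y → G.Adj x z → d y ≤ d x → d z ≤ d x → y = z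

/-- A neighbour of `x` that is no farther from the root is the penultimate vertex of a path from `r`
to `x`, and that path is unique in a tree. -/
theorem isDepth_dist {T : SimpleGraph V} (hT : T.IsTree) (r : V) : IsDepth T (T.dist r) := by
  classical
  have key : ∀ x y, T.Adj x y → T.dist r y ≤ T.dist r x →
      ∃ p : T.Walk r x, p.IsPath ∧ p.penultimate = y := by
    intro x y hxy hd
    obtain ⟨p, hp, hl⟩ := hT.1.exists_path_of_dist r y
    -- A geodesic to `y` through `x` would make `x` strictly closer to the root than `y`.
    have hx : x ∉ p.support := by
      intro hx
      have h1 := SimpleGraph.Walk.length_takeUntil_lt_length hx hxy.ne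
      have h2 := SimpleGraph.dist_le (p.takeUntil x hx)
      omega
    exact ⟨p.concat hxy.symm, hp.concat hx _, by simp⟩
  intro x y z hy hz hdy hdz
  obtain ⟨p, hp, rfl⟩ := key x y hy hdy
  obtain ⟨q, hq, rfl⟩ := key x z hz hdz
  have := (hT.2.subsingleton_path r x).elim ⟨p, hp⟩ ⟨q, hq⟩
  rw [Subtype.mk.injEq] at this
  rw [this]

/-- The only form in which acyclicity is used: around a closed walk without backtracking, no vertex
could attain the maximal depth. -/
theorem IsDepth.lt_or_lt {G : SimpleGraph V} {d : V → ℕ} (hd : IsDepth G d) {x y z : V}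
    (hy : G.Adj y x) (hz : G.Adj x z) (hne : y ≠ z) : d x < d y ∨ d x < d z := by
  by_contra! h
  exact hne (hd hy.symm hz h.1 h.2)

theorem IsDepth.no_four_cycle {G : SimpleGraph V} {d : V → ℕ} (hd : IsDepth G d) {a b x y : V}
    (hax : G.Adj a x) (hay : G.Adj a y) (hbx : G.Adj b x) (hby : G.Adj b y) (hxy : x ≠ y) :
    a = b := by
  by_contra hab
  have h1 := hd.lt_or_lt hax.symm hay hxy
  have h2 := hd.lt_or_lt hay hby.symm hab
  have h3 := hd.lt_or_lt hby.symm hbx hxy.symm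
  have h4 := hd.lt_or_lt hbx hax.symm (Ne.symm hab)
  omega

theorem IsDepth.no_eight_cycle {G : SimpleGraph V} {d : V → ℕ} (hd : IsDepth G d)
    {x₁ x₂ x₃ x₄ x₅ x₆ x₇ x₈ : V}
    (a₁ : G.Adj x₁ x₂) (a₂ : G.Adj x₂ x₃) (a₃ : G.Adj x₃ x₄) (a₄ : G.Adj x₄ x₅)
    (a₅ : G.Adj x₅ x₆) (a₆ : G.Adj x₆ x₇) (a₇ : G.Adj x₇ x₈) (a₈ : G.Adj x₈ x₁)
    (n₁ : x₈ ≠ x₂) (n₂ : x₁ ≠ x₃) (n₃ : x₂ ≠ x₄) (n₄ : x₃ ≠ x₅)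
    (n₅ : x₄ ≠ x₆) (n₆ : x₅ ≠ x₇) (n₇ : x₆ ≠ x₈) (n₈ : x₇ ≠ x₁) : False := by
  have h1 := hd.lt_or_lt a₈ a₁ n₁
  have h2 := hd.lt_or_lt a₁ a₂ n₂
  have h3 := hd.lt_or_lt a₂ a₃ n₃
  have h4 := hd.lt_or_lt a₃ a₄ n₄
  have h5 := hd.lt_or_lt a₄ a₅ n₅
  have h6 := hd.lt_or_lt a₅ a₆ n₆
  have h7 := hd.lt_or_lt a₆ a₇ n₇
  have h8 := hd.lt_or_lt a₇ a₈ n₈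
  omega

/-- König property of the open neighbourhoods: some of them are pairwise disjoint and have a
system of representatives meeting them all. -/
theorem IsDepth.exists_matching {G : SimpleGraph V} {d : V → ℕ} (hd : IsDepth G d)
    (hG : ∀ v, ∃ w, G.Adj v w) (s : Finset V) :
    ∃ M ⊆ s, ∃ p : V → V, (∀ a, G.Adj a (p a)) ∧
      (∀ a ∈ M, ∀ b ∈ M, ∀ x, G.Adj a x → G.Adj b x → a = b) ∧
      ∀ a ∈ s, ∃ m ∈ M, G.Adj a (p m) := by
  classical
  -- `p a` is the parent of `a`; if all neighbours are strictly higher, any neighbour will do.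
  have hp : ∀ a, ∃ p, G.Adj a p ∧ ∀ x, G.Adj a x → d x ≤ d a → x = p := by
    intro a
    by_cases h : ∃ p, G.Adj a p ∧ d p ≤ d a
    · obtain ⟨p, h1, h2⟩ := h
      exact ⟨p, h1, fun x hx hxd => hd hx h1 hxd h2⟩
    · obtain ⟨w, hw⟩ := hG a
      exact ⟨w, hw, fun x hx hxd => (h ⟨x, hx, hxd⟩).elim⟩
  choose p hp1 hp2 using hp
  suffices H : ∃ M ⊆ s, (∀ a ∈ M, ∀ b ∈ M, ∀ x, G.Adj a x → G.Adj b x → a = b) ∧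
      ∀ a ∈ s, ∃ m ∈ M, G.Adj a (p m) by
    obtain ⟨M, h1, h2, h3⟩ := H
    exact ⟨M, h1, p, hp1, h2, h3⟩
  -- Vertices enter from the deepest up, so a neighbour common to the new `a` and an earlier `b`
  -- must be the parent of `b`.
  induction s using Finset.induction_on_min_value d with
  | empty => exact ⟨∅, by simp⟩
  | insert a s has hmin ih =>
    obtain ⟨M, hMs, hdisj, hcov⟩ := ih
    by_cases ha : ∃ m ∈ M, G.Adj a (p m)
    · refine ⟨M, hMs.trans (subset_insert _ _), hdisj, fun b hb => ?_⟩
      rcases mem_insert.1 hb with rfl | hb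
      · exact ha
      · exact hcov b hb
    · have hnew : ∀ b ∈ M, ∀ x, G.Adj a x → ¬ G.Adj b x := by
        intro b hb x hax hbx
        have hne : a ≠ b := fun h => has (h ▸ hMs hb)
        have hab := hmin b (hMs hb)
        have := hd.lt_or_lt hax hbx.symm hne
        have hx : x = p b := hp2 b x hbx (by omega)
        exact ha ⟨b, hb, hx ▸ hax⟩
      refine ⟨insert a M, insert_subset_insert _ hMs, ?_, fun b hb => ?_⟩
      · intro b hb c hc x hbx hcx
        rcases mem_insert.1 hb with rfl | hb' <;> rcases mem_insert.1 hc with rfl | hc'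
        · rfl
        · exact (hnew c hc' x hbx hcx).elim
        · exact (hnew b hb' x hcx hbx).elim
        · exact hdisj b hb' c hc' x hbx hcx
      · rcases mem_insert.1 hb with rfl | hb
        · exact ⟨b, mem_insert_self _ _, hp1 b⟩
        · obtain ⟨m, hm, h⟩ := hcov b hb
          exact ⟨m, mem_insert_of_mem hm, h⟩

end Depth

section TDSets

variable {V : Type*} {G : SimpleGraph V}

theorem isTDSet_iff {D : Finset V} : IsTDSet G D ↔ ∀ v, ∃ x ∈ D, G.Adj v x := by
  simp only [IsTDSet, Set.eq_univ_iff_forall, Set.mem_iUnion, SimpleGraph.mem_neighborSet,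
    exists_prop, G.adj_comm]

theorem IsTDSet.mono {D D' : Finset V} (h : IsTDSet G D) (hD : D ⊆ D') : IsTDSet G D' := by
  rw [isTDSet_iff] at *
  exact fun v => (h v).imp fun x hx => ⟨hD hx.1, hx.2⟩

theorem IsTDSet.exists_minimal {D : Finset V} (h : IsTDSet G D) :
    ∃ D' ⊆ D, IsMinimalTDSet G D' := by
  obtain ⟨D', h1, h2⟩ := exists_minimal_le_of_wellFoundedLT (IsTDSet G) D h
  exact ⟨D', h1, h2⟩

/-- The open neighbourhood of `a` is minimal among all open neighbourhoods. -/
def HasMinimalNbhd (G : SimpleGraph V) (a : V) : Prop :=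
  ∀ b, G.neighborSet b ⊆ G.neighborSet a → G.neighborSet a ⊆ G.neighborSet b

theorem exists_hasMinimalNbhd [Finite V] (G : SimpleGraph V) (v : V) :
    ∃ a, HasMinimalNbhd G a ∧ G.neighborSet a ⊆ G.neighborSet v := by
  obtain ⟨N, hN, ⟨a, rfl⟩, hmin⟩ :=
    exists_minimal_le_of_wellFoundedLT (· ∈ Set.range G.neighborSet) (G.neighborSet v) ⟨v, rfl⟩
  exact ⟨a, fun b hb => hmin ⟨b, rfl⟩ hb, hN⟩

theorem isTDSet_of_hasMinimalNbhd [Finite V] {D : Finset V}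
    (h : ∀ a, HasMinimalNbhd G a → ∃ x ∈ D, G.Adj a x) : IsTDSet G D := by
  rw [isTDSet_iff]
  intro v
  obtain ⟨a, ha, hav⟩ := exists_hasMinimalNbhd G v
  obtain ⟨x, hx, hax⟩ := h a ha
  exact ⟨x, hx, hav hax⟩

/-- The open neighbourhoods of the vertices in `M` are pairwise disjoint. -/
def DisjointNbhds (G : SimpleGraph V) (M : Finset V) : Prop :=
  ∀ a ∈ M, ∀ b ∈ M, ∀ x, G.Adj a x → G.Adj b x → a = b

theorem DisjointNbhds.injOn {M : Finset V} (hM : DisjointNbhds G M) {c : V → V}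
    (hc : ∀ a ∈ M, G.Adj a (c a)) : Set.InjOn c M := fun a ha b hb hab =>
  hM a ha b hb (c a) (hc a ha) (hab ▸ hc b hb)

theorem DisjointNbhds.exists_image_subset [DecidableEq V] {M D : Finset V}
    (hM : DisjointNbhds G M) (hD : IsTDSet G D) :
    ∃ c : V → V, (∀ a ∈ M, G.Adj a (c a)) ∧ M.image c ⊆ D ∧ (M.image c).card = M.card := by
  rw [isTDSet_iff] at hD
  choose c hcD hc using hD
  exact ⟨c, fun a _ => hc a, by simpa [image_subset_iff] using fun a _ => hcD a,
    card_image_of_injOn (hM.injOn fun a _ => hc a)⟩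

theorem DisjointNbhds.card_le {M D : Finset V} (hM : DisjointNbhds G M) (hD : IsTDSet G D) :
    M.card ≤ D.card := by
  classical
  obtain ⟨c, -, h1, h2⟩ := hM.exists_image_subset hD
  exact h2 ▸ card_le_card h1

theorem DisjointNbhds.exists_eq_image [DecidableEq V] {M D : Finset V} (hM : DisjointNbhds G M)
    (hD : IsTDSet G D) (hcard : D.card = M.card) :
    ∃ c : V → V, (∀ a ∈ M, G.Adj a (c a)) ∧ D = M.image c := by
  obtain ⟨c, hc, h1, h2⟩ := hM.exists_image_subset hD
  exact ⟨c, hc, (eq_of_subset_of_card_le h1 (by omega)).symm⟩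

theorem DisjointNbhds.eq_of_mem_image [DecidableEq V] {M : Finset V} (hM : DisjointNbhds G M)
    {c : V → V} (hc : ∀ a ∈ M, G.Adj a (c a)) {a x : V} (ha : a ∈ M) (hax : G.Adj a x)
    (hx : x ∈ M.image c) : x = c a := by
  obtain ⟨b, hb, rfl⟩ := mem_image.1 hx
  rw [hM a ha b hb _ hax (hc b hb)]

theorem DisjointNbhds.isMinimalTDSet {M D : Finset V} (hM : DisjointNbhds G M)
    (hD : IsTDSet G D) (hcard : D.card = M.card) : IsMinimalTDSet G D :=
  ⟨hD, fun _ hD' hle => (eq_of_subset_of_card_le hle (hcard ▸ hM.card_le hD')).ge⟩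

/-- A vertex lying in two different minimal open neighbourhoods. -/
def IsShared (G : SimpleGraph V) (x : V) : Prop :=
  ∃ a b, HasMinimalNbhd G a ∧ HasMinimalNbhd G b ∧ G.Adj a x ∧ G.Adj b x ∧
    G.neighborSet a ≠ G.neighborSet b

theorem IsShared.exists_ne {x : V} (hx : IsShared G x) (e : V) :
    ∃ g, HasMinimalNbhd G g ∧ G.Adj g x ∧ g ≠ e := by
  obtain ⟨a, b, ha, hb, hax, hbx, hab⟩ := hx
  by_cases h : a = e
  · exact ⟨b, hb, hbx, fun h' => hab (by rw [h, h'])⟩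
  · exact ⟨a, ha, hax, h⟩

/-- In a tree, two neighbours of a vertex which both lie in a further minimal open neighbourhood
belong to a common minimal TD-set. -/
theorem IsDepth.exists_minimalTDSet_of_isShared [Finite V] {d : V → ℕ} (hd : IsDepth G d)
    {e u v : V} (heu : G.Adj e u) (hev : G.Adj e v) (huv : u ≠ v)
    (hu : IsShared G u) (hv : IsShared G v) :
    ∃ D, IsMinimalTDSet G D ∧ u ∈ D ∧ v ∈ D := by
  classical
  have := Fintype.ofFinite V
  obtain ⟨g, hg, hgu, hge⟩ := hu.exists_ne e
  obtain ⟨h, hh, hhv, hhe⟩ := hv.exists_ne e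
  have hgv : ¬ G.Adj g v := fun hgv => hge (hd.no_four_cycle hgu hgv heu hev huv)
  have hhu : ¬ G.Adj h u := fun hhu => hhe (hd.no_four_cycle hhu hhv heu hev huv)
  -- Within `W`, only `u` can dominate `g` and only `v` can dominate `h`.
  let W : Finset V := univ.filter fun x => (G.Adj g x → x = u) ∧ (G.Adj h x → x = v)
  have hW : IsTDSet G W := by
    rw [isTDSet_iff]
    intro k
    by_contra! hk
    have hk' : ∀ x, G.Adj k x → (G.Adj g x ∧ x ≠ u) ∨ (G.Adj h x ∧ x ≠ v) := by
      intro x hx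
      by_contra! hcon
      exact hk x (by simpa [W] using hcon) hx
    have hku : ¬ G.Adj k u := fun hku => by
      rcases hk' u hku with h1 | h1
      · exact h1.2 rfl
      · exact hhu h1.1
    have hkv : ¬ G.Adj k v := fun hkv => by
      rcases hk' v hkv with h1 | h1
      · exact hgv h1.1
      · exact h1.2 rfl
    -- Minimality of N(g) and N(h) forces N(k) to leave both, which closes the cycle u g z k y h v
    -- e.
    obtain ⟨y, hky, hgy⟩ := Set.not_subset.1 fun hs => hku (hg k hs hgu)
    obtain ⟨z, hkz, hhz⟩ := Set.not_subset.1 fun hs => hkv (hh k hs hhv)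
    simp only [SimpleGraph.mem_neighborSet] at hky hgy hkz hhz
    have hy := (hk' y hky).resolve_left fun h1 => hgy h1.1
    have hz := (hk' z hkz).resolve_right fun h1 => hhz h1.1
    exact hd.no_eight_cycle hgu.symm hz.1 hkz.symm hky hy.1.symm hhv hev.symm heu
      hge.symm hz.2.symm (fun h1 => hku (h1 ▸ hgu)) (fun h1 => hhz (h1 ▸ hy.1))
      (fun h1 => hkv (h1 ▸ hhv)) hy.2 hhe huv.symm
  obtain ⟨D, hDW, hD⟩ := hW.exists_minimal
  have hTD := isTDSet_iff.1 hD.1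
  refine ⟨D, hD, ?_, ?_⟩
  · obtain ⟨x, hxD, hgx⟩ := hTD g
    exact (mem_filter.1 (hDW hxD)).2.1 hgx ▸ hxD
  · obtain ⟨x, hxD, hhx⟩ := hTD h
    exact (mem_filter.1 (hDW hxD)).2.2 hhx ▸ hxD

/-- In an unmixed tree, the minimal TD-sets are transversals of disjoint minimal open
neighbourhoods, each containing at most one shared vertex. -/
theorem IsDepth.exists_disjointNbhds [Finite V] {d : V → ℕ} (hd : IsDepth G d)
    (hG : ∀ v, ∃ w, G.Adj v w) (hU : IsUnmixed G) :
    ∃ M : Finset V, DisjointNbhds G M ∧ (∀ a ∈ M, HasMinimalNbhd G a) ∧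
      (∀ D, IsMinimalTDSet G D → D.card = M.card) ∧
      ∀ a ∈ M, ∀ u v, G.Adj a u → G.Adj a v → IsShared G u → IsShared G v → u = v := by
  classical
  have := Fintype.ofFinite V
  obtain ⟨M, hMs, p, hp, hM, hcov⟩ := hd.exists_matching hG (univ.filter (HasMinimalNbhd G))
  replace hM : DisjointNbhds G M := hM
  have hTD : IsTDSet G (M.image p) := isTDSet_of_hasMinimalNbhd fun a ha => by
    obtain ⟨m, hm, h⟩ := hcov a (by simpa using ha)
    exact ⟨p m, mem_image_of_mem p hm, h⟩
  have hc : (M.image p).card = M.card := card_image_of_injOn (hM.injOn fun a _ => hp a)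
  have hcard : ∀ D, IsMinimalTDSet G D → D.card = M.card := fun D hD =>
    (hU D _ hD (hM.isMinimalTDSet hTD hc)).trans hc
  refine ⟨M, hM, fun a ha => (mem_filter.1 (hMs ha)).2, hcard, ?_⟩
  intro a ha u v hau hav hu hv
  by_contra huv
  obtain ⟨D, hD, huD, hvD⟩ := hd.exists_minimalTDSet_of_isShared hau hav huv hu hv
  obtain ⟨c, hc, rfl⟩ := hM.exists_eq_image hD.1 (hcard D hD)
  exact huv ((hM.eq_of_mem_image hc ha hau huD).trans (hM.eq_of_mem_image hc ha hav hvD).symm)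

/-- The exchange property behind the shelling. -/
theorem DisjointNbhds.exists_exchange [Finite V] [DecidableEq V] {M : Finset V}
    (hM : DisjointNbhds G M) (hmin : ∀ a ∈ M, HasMinimalNbhd G a)
    (hcard : ∀ D, IsMinimalTDSet G D → D.card = M.card)
    (hshared : ∀ a ∈ M, ∀ u v, G.Adj a u → G.Adj a v → IsShared G u → IsShared G v → u = v)
    {ρ : V → ℕ} (hρ : Function.Injective ρ) (hρs : ∀ x y, IsShared G x → ρ y < ρ x → IsShared G y)
    {D D' : Finset V} (hD : IsMinimalTDSet G D) (hD' : IsMinimalTDSet G D') (hne : D ≠ D')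
    (hle : ∑ x ∈ D, ρ x ≤ ∑ x ∈ D', ρ x) :
    ∃ v ∈ D \ D', ∃ D'', IsMinimalTDSet G D'' ∧ ∑ x ∈ D'', ρ x < ∑ x ∈ D', ρ x ∧
      D'' \ D' = {v} := by
  have hcD' := hcard D' hD'
  have hTD := isTDSet_iff.1 hD'.1
  obtain ⟨c, hc, rfl⟩ := hM.exists_eq_image hD.1 (hcard D hD)
  obtain ⟨c', hc', hDc⟩ := hM.exists_eq_image hD'.1 hcD'
  -- Otherwise the weights agree term by term, and injectivity of `ρ` gives `D = D'`.
  obtain ⟨a, ha, hlt⟩ : ∃ a ∈ M, ρ (c a) < ρ (c' a) := by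
    by_contra! hcon
    rw [hDc, sum_image (hM.injOn hc), sum_image (hM.injOn hc')] at hle
    have heq := (sum_eq_sum_iff_of_le hcon).1 (le_antisymm (sum_le_sum hcon) hle)
    refine hne (hDc ▸ image_congr fun a ha => (hρ (heq a ha)).symm)
  have hv : c a ∉ D' := fun h => by
    rw [hDc] at h
    rw [hM.eq_of_mem_image hc' ha (hc a ha) h] at hlt
    exact lt_irrefl _ hlt
  have hw : c' a ∈ D' := hDc ▸ mem_image_of_mem c' ha
  have hw_shared : ¬ IsShared G (c' a) := fun h => by
    rw [hshared a ha _ _ (hc a ha) (hc' a ha) (hρs _ _ h hlt) h] at hlt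
    exact lt_irrefl _ hlt
  have hv' : c a ∉ D'.erase (c' a) := fun h => hv (mem_of_mem_erase h)
  refine ⟨c a, mem_sdiff.2 ⟨mem_image_of_mem c ha, hv⟩, insert (c a) (D'.erase (c' a)),
    hM.isMinimalTDSet (isTDSet_of_hasMinimalNbhd fun b hb => ?_) ?_, ?_, ?_⟩
  · obtain ⟨x, hx, hbx⟩ := hTD b
    by_cases h : x = c' a
    · subst h
      -- As `c' a` is not shared, every minimal neighbourhood containing it is N(a), which also
      -- contains `c a`.
      have hN : G.neighborSet a = G.neighborSet b := by
        by_contra hN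
        exact hw_shared ⟨a, b, hmin a ha, hb, hc' a ha, hbx, hN⟩
      have : c a ∈ G.neighborSet b := hN ▸ hc a ha
      exact ⟨c a, mem_insert_self _ _, this⟩
    · exact ⟨x, mem_insert_of_mem (mem_erase.2 ⟨h, hx⟩), hbx⟩
  · rw [card_insert_of_notMem hv', card_erase_add_one hw, hcD']
  · rw [sum_insert hv', ← add_sum_erase D' ρ hw]
    omega
  · ext x
    simp only [mem_sdiff, mem_insert, mem_erase, mem_singleton]
    constructor
    · tauto
    · rintro rfl
      exact ⟨Or.inl rfl, hv⟩

theorem exists_rank [Finite V] (S : V → Prop) :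
    ∃ ρ : V → ℕ, Function.Injective ρ ∧ ∀ x y, S x → ρ y < ρ x → S y := by
  classical
  have := Fintype.ofFinite V
  let e := Fintype.equivFin V
  have he : ∀ x, (e x : ℕ) < Fintype.card V := fun x => (e x).2
  -- The values of `e` are below `Fintype.card V`, so this shift lifts everything outside `S` above
  -- `S`.
  refine ⟨fun x => e x + if S x then 0 else Fintype.card V, fun x y hxy => ?_, fun x y hx h => ?_⟩
  · have hx := he x
    have hy := he y
    refine e.injective (Fin.ext ?_)
    dsimp only at hxy
    split_ifs at hxy <;> omega
  · by_contra hy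
    have hx' := he x
    simp only [hx, hy, if_true, if_false] at h
    omega

theorem IsDepth.exists_exchange [Finite V] [DecidableEq V] {d : V → ℕ} (hd : IsDepth G d)
    (hU : IsUnmixed G) :
    ∃ w : Finset V → ℕ, ∀ D D', IsMinimalTDSet G D → IsMinimalTDSet G D' → D ≠ D' →
      w D ≤ w D' → ∃ v ∈ D \ D', ∃ D'', IsMinimalTDSet G D'' ∧ w D'' < w D' ∧ D'' \ D' = {v} := by
  by_cases hG : ∀ v, ∃ w, G.Adj v w
  · obtain ⟨M, hM, hmin, hcard, hshared⟩ := hd.exists_disjointNbhds hG hU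
    obtain ⟨ρ, hρ, hρs⟩ := exists_rank (IsShared G)
    exact ⟨fun D => ∑ x ∈ D, ρ x, fun D D' hD hD' hne hle =>
      hM.exists_exchange hmin hcard hshared hρ hρs hD hD' hne hle⟩
  -- An isolated vertex rules out TD-sets, so the claim is vacuous.
  · exact ⟨fun _ => 0, fun D _ hD => (hG fun v => (isTDSet_iff.1 hD.1 v).imp fun _ h => h.2).elim⟩

end TDSets

section Complexes

variable {V : Type*} [Fintype V] [DecidableEq V]

/-- Sorting by `w` may break ties arbitrarily: the hypothesis covers equal weights, while its strict
drop places `F''` earlier. -/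
theorem exists_isShelling {Δ : LowerSet (Finset V)} (w : Finset V → ℕ)
    (h : ∀ F ∈ facets Δ, ∀ F' ∈ facets Δ, F ≠ F' → w F ≤ w F' →
      ∃ v ∈ F' \ F, ∃ F'' ∈ facets Δ, w F'' < w F' ∧ F' \ F'' = {v}) :
    ∃ (m : ℕ) (F : Fin m → Finset V), IsShelling Δ F := by
  classical
  let e := (Fintype.equivFin (facets Δ)).symm
  let σ := Tuple.sort fun i => w (e i)
  have hmono : Monotone ((fun i => w (e i)) ∘ σ) := Tuple.monotone_sort _
  refine ⟨_, fun i => e (σ i), ?_, ?_, fun i j hij => ?_⟩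
  · exact Subtype.val_injective.comp (e.injective.comp σ.injective)
  · ext F
    constructor
    · rintro ⟨i, rfl⟩
      exact (e (σ i)).2
    · intro hF
      exact ⟨σ.symm (e.symm ⟨F, hF⟩), by simp⟩
  · have hne : (e (σ i) : Finset V) ≠ e (σ j) := fun heq =>
      hij.ne (σ.injective (e.injective (Subtype.ext heq)))
    obtain ⟨v, hv, F, hF, hlt, hFv⟩ := h _ (e (σ i)).2 _ (e (σ j)).2 hne (hmono hij.le)
    refine ⟨v, hv, σ.symm (e.symm ⟨F, hF⟩), ?_, by simpa using hFv⟩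
    refine hmono.reflect_lt ?_
    simpa using hlt

theorem facets_stableComplex (G : SimpleGraph V) :
    facets (stableComplex G) = {F : Finset V | IsMinimalTDSet G Fᶜ} := by
  ext F
  simp only [facets, stableComplex, Set.mem_ofPred_eq, mem_lowerClosure, IsMaximalStable]
  constructor
  · rintro ⟨⟨F', hF', hle⟩, hmax⟩
    rwa [le_antisymm hle (hmax ⟨F', hF', le_rfl⟩ hle)]
  · intro hF
    refine ⟨⟨F, hF, le_rfl⟩, ?_⟩
    rintro F' ⟨F'', hF'', hle'⟩ hle
    have h1 := hF.2 hF''.1 (compl_le_compl (hle.trans hle'))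
    exact hle'.trans (compl_le_compl_iff_le.1 h1)

theorem mem_stableComplex_iff {G : SimpleGraph V} {F : Finset V} :
    F ∈ stableComplex G ↔ IsTDSet G Fᶜ := by
  simp only [stableComplex, mem_lowerClosure, Set.mem_ofPred_eq, IsMaximalStable]
  constructor
  · rintro ⟨F', hF', hle⟩
    exact hF'.1.mono (compl_le_compl hle)
  · intro h
    obtain ⟨D, hDF, hD⟩ := h.exists_minimal
    exact ⟨Dᶜ, by rwa [compl_compl], by simpa using compl_le_compl hDF⟩

theorem isShellable_stableComplex {G : SimpleGraph V} {d : V → ℕ} (hd : IsDepth G d)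
    (hU : IsUnmixed G) : IsShellable (stableComplex G) := by
  obtain ⟨w, hw⟩ := hd.exists_exchange hU
  refine ⟨fun F hF F' hF' => ?_, exists_isShelling (fun F => w Fᶜ) fun F hF F' hF' hne hle => ?_⟩
  · rw [facets_stableComplex] at hF hF'
    have h := hU _ _ hF hF'
    rw [card_compl, card_compl] at h
    have := card_le_univ F
    have := card_le_univ F'
    omega
  · rw [facets_stableComplex] at hF hF' ⊢
    -- Complementation reverses differences, hence the exchanged roles of the two sets in the
    -- exchange property.
    have key : ∀ A B : Finset V, Aᶜ \ Bᶜ = B \ A := fun A B => compl_sdiff_compl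
    obtain ⟨v, hv, D, hD, hlt, hDv⟩ := hw _ _ hF hF' (fun h => hne (compl_injective h)) hle
    refine ⟨v, key F F' ▸ hv, Dᶜ, ?_, by simpa using hlt, ?_⟩
    · simpa using hD
    · rw [← hDv, ← key, compl_compl]

end Complexes

section Ideals

open MvPolynomial

variable {V : Type*}

theorem setMonomial_eq_monomial (K : Type*) [CommRing K] (U : Finset V) :
    setMonomial K U = monomial (∑ v ∈ U, Finsupp.single v 1) 1 := by
  simp only [setMonomial, X, monomial_sum_one]

theorem sum_single_le_iff {U F : Finset V} :
    (∑ v ∈ U, Finsupp.single v 1 : V →₀ ℕ) ≤ ∑ v ∈ F, Finsupp.single v 1 ↔ U ⊆ F := by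
  classical
  have key : ∀ (W : Finset V) (x : V),
      (∑ v ∈ W, Finsupp.single v 1 : V →₀ ℕ) x = if x ∈ W then 1 else 0 := fun W x => by
    simp [Finsupp.finsetSum_apply, Finsupp.single_apply]
  simp only [Finsupp.le_def, key]
  refine ⟨fun h x hx => ?_, fun h x => ?_⟩
  · by_contra hF
    simpa [hx, hF] using h x
  · by_cases hx : x ∈ U
    · simp [hx, h hx]
    · simp [hx]

/-- A monomial lies in a monomial ideal exactly when a generator divides it; for square-free
monomials divisibility is inclusion of supports. -/
theorem setMonomial_mem_openNeighborhoodIdeal [Fintype V] (K : Type*) [CommRing K] [Nontrivial K]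
    (G : SimpleGraph V) [DecidableRel G.Adj] (F : Finset V) :
    setMonomial K F ∈ openNeighborhoodIdeal K G ↔ ∃ v, G.neighborFinset v ⊆ F := by
  have hspan : {f | ∃ v : V, f = setMonomial K (G.neighborFinset v)} =
      (fun s => monomial s (1 : K)) ''
        Set.range fun v => ∑ u ∈ G.neighborFinset v, Finsupp.single u 1 := by
    ext f
    simp [setMonomial_eq_monomial, eq_comm]
  classical
  rw [openNeighborhoodIdeal, hspan, mem_ideal_span_monomial_image, setMonomial_eq_monomial,
    support_monomial, if_neg one_ne_zero]
  simp [sum_single_le_iff]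

theorem stanleyReisnerComplex_openNeighborhoodIdeal [Fintype V] [DecidableEq V] (K : Type*)
    [CommRing K] [Nontrivial K] (G : SimpleGraph V) [DecidableRel G.Adj] :
    stanleyReisnerComplex (openNeighborhoodIdeal K G) = stableComplex G := by
  ext F
  change setMonomial K F ∉ openNeighborhoodIdeal K G ↔ F ∈ stableComplex G
  rw [setMonomial_mem_openNeighborhoodIdeal, mem_stableComplex_iff, isTDSet_iff]
  simp [Finset.not_subset, and_comm]

end Ideals

end OpenNbhd

theorem mainTheorem7 {V : Type*} [Fintype V] [DecidableEq V]
    (T : SimpleGraph V) [DecidableRel T.Adj] (hT : T.IsTree) (hU : OpenNbhd.IsUnmixed T) :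
    OpenNbhd.IsShellable (OpenNbhd.stableComplex T) ∧
      OpenNbhd.facets (OpenNbhd.stableComplex T) =
        {F : Finset V | OpenNbhd.IsMinimalTDSet T Fᶜ} ∧
      ∀ (K : Type*) [Field K],
        OpenNbhd.stanleyReisnerComplex (OpenNbhd.openNeighborhoodIdeal K T) =
          OpenNbhd.stableComplex T := by
  obtain ⟨r⟩ := hT.1.nonempty
  exact ⟨OpenNbhd.isShellable_stableComplex (OpenNbhd.isDepth_dist hT r) hU,
    OpenNbhd.facets_stableComplex T,
    fun K _ => OpenNbhd.stanleyReisnerComplex_openNeighborhoodIdeal K T⟩
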